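/- Work with a fixed notion of smallness, let $\mathbf{Cat}$ be the 2-category of small categories and $\mathbf{CAT}$ the 2-category of locally small categories. For a small category $D$, let $D_\top$ be the category obtained from $D$ by freely adjoining a terminal object $\top$ (so $\operatorname{ob} D_\top = \operatorname{ob} D \sqcup \{\top\}$, each object has exactly one morphism to $\top$, and there are no morphisms from $\top$ to objects of $D$). For a class $\Phi$ of small categories, a category is *$\Phi$-cocomplete* if it has colimits of all diagrams of shape $D$ for each $D \in \Phi$, and a functor is *$\Phi$-cocontinuous* if it preserves all such colimits. For a small category $X$ let $\overline\Phi(X)$ be the smallest full replete subcategory of $[X^{\mathrm{op}}, \mathbf{Set}]$ that contains the representables and is closed under colimits of shape $D$ for $D \in \Phi$. The assignment $X \mapsto \overline\Phi(X)$ is a relative pseudomonad along the inclusion $\mathbf{Cat} \hookrightarrow \mathbf{CAT}$, whose unit $\phi_X \colon X \to \overline\Phi(X)$ is the Yoneda embedding, whose extension operator sends $f \colon X \to \overline\Phi(Y)$ to its left extension $f^* \colon \overline\Phi(X) \to \overline\Phi(Y)$ along $\phi_X$, and whose invertible 2-cells $\eta_f \colon f \Rightarrow f^*\phi_X$, $\mu_{g,f}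 \colon (g^*f)^* \Rightarrow g^*f^*$ and $\theta_X \colon (\phi_X)^* \Rightarrow 1$ are induced by the universal property of left extensions. Let $\Phi \subseteq \Phi'$ be classes of small categories such that $D \in \Phi$ implies $D_\top \in \Phi'$, let $J \colon \Phi' \hookrightarrow \mathbf{CAT}$ be the inclusion of the full sub-2-category spanned by $\Phi'$, and let $\overline\Phi J$ be the restriction of the relative pseudomonad $\overline\Phi$ to $\Phi'$. A *pseudoalgebra* for $\overline\Phi J$ is a locally small category $A$ with functors $(-)^a \colon \mathbf{CAT}[X, A] \to \mathbf{CAT}[\overline\Phi(X), A]$ for each $X \in \Phi'$ and natural families of invertible 2-cells $\hat a_{g,f} \colon (g^a f)^a \Rightarrow g^a f^*$ and $\tilde a_f \colon f \Rightarrow f^a \phi_X$, satisfying the associativity law $(\hat a_{h,g} f^*) \circ \hat a_{h^a g, f} = (h^a \mu_{g,f}) \circ \hat a_{h, g^* f} \circ (\hat a_{h,g} f)^a$ and the unit law $(f^a \theta_X) \circ \hat a_{f,\phi_X} \circ (\tilde a_f)^a = 1_{f^a}$. A *pseudomorphism* $A \to B$ is a functor $h$ with a natural family of invertible 2-cells $\overline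 h_f \colon (hf)^b \Rightarrow h f^a$ satisfying $(h \hat a_{g,f}) \circ \overline h_{g^a f} \circ (\overline h_g f)^b = (\overline h_g f^*) \circ \hat b_{hg,f}$ and $(\overline h_f \phi_X) \circ \tilde b_{hf} = h \tilde a_f$. A pseudoalgebra is *lax-idempotent* if, for each $X \in \Phi'$, the 2-cells $\tilde a_f$ are the components of the unit of an adjunction $(-)^a \dashv (-) \circ \phi_X$ between $\mathbf{CAT}[X, A]$ and $\mathbf{CAT}[\overline\Phi(X), A]$. Then: 1. the underlying category of every $\overline\Phi J$-pseudoalgebra is $\Phi$-cocomplete; 2. the underlying functor of every pseudomorphism of $\overline\Phi J$-pseudoalgebras is $\Phi$-cocontinuous; 3. every $\overline\Phi J$-pseudoalgebra is lax-idempotent. -/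

import Mathlib

open CategoryTheory Bicategory Limits

universe w₁ w₂ w₃ v v₁ v₂ v₃ u₁ u₂ u₃

/-- A relative pseudomonad on a pseudofunctor `J : A ⥤ᵖ E` of bicategories. Composites are written
in diagrammatic order, so `f ≫ (ext Y Z).obj g` is `g^* f`. -/
structure RelativePseudomonad {A : Type u₁} [Bicategory.{w₁, v₁} A]
    {E : Type u₂} [Bicategory.{w₂, v₂} E] (J : A ⥤ᵖ E) where
  /-- the object `T X` -/
  obj : A → E
  /-- the extension operator `f ↦ f^*` -/
  ext (X Y : A) : (J.obj X ⟶ obj Y) ⥤ (obj X ⟶ obj Y)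
  /-- the unit `i_X` -/
  unit (X : A) : J.obj X ⟶ obj X
  /-- `μ_{g,f} : (g^* f)^* ≅ g^* f^*` -/
  mu {X Y Z : A} (g : J.obj Y ⟶ obj Z) (f : J.obj X ⟶ obj Y) :
    (ext X Z).obj (f ≫ (ext Y Z).obj g) ≅ (ext X Y).obj f ≫ (ext Y Z).obj g
  mu_naturality_left {X Y Z : A} {g g' : J.obj Y ⟶ obj Z} (γ : g ⟶ g') (f : J.obj X ⟶ obj Y) :
    (ext X Z).map (f ◁ (ext Y Z).map γ) ≫ (mu g' f).hom =
      (mu g f).hom ≫ (ext X Y).obj f ◁ (ext Y Z).map γ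
  mu_naturality_right {X Y Z : A} (g : J.obj Y ⟶ obj Z) {f f' : J.obj X ⟶ obj Y} (φ : f ⟶ f') :
    (ext X Z).map (φ ▷ (ext Y Z).obj g) ≫ (mu g f').hom =
      (mu g f).hom ≫ (ext X Y).map φ ▷ (ext Y Z).obj g
  /-- `η_f : f ≅ f^* i_X` -/
  eta {X Y : A} (f : J.obj X ⟶ obj Y) : f ≅ unit X ≫ (ext X Y).obj f
  eta_naturality {X Y : A} {f f' : J.obj X ⟶ obj Y} (φ : f ⟶ f') :
    φ ≫ (eta f').hom = (eta f).hom ≫ unit X ◁ (ext X Y).map φ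
  /-- `θ_X : (i_X)^* ≅ 1_{T X}` -/
  theta (X : A) : (ext X X).obj (unit X) ≅ 𝟙 (obj X)
  associativity {W X Y Z : A} (f : J.obj W ⟶ obj X) (g : J.obj X ⟶ obj Y) (h : J.obj Y ⟶ obj Z) :
    (mu (g ≫ (ext Y Z).obj h) f).hom ≫ (ext W X).obj f ◁ (mu h g).hom ≫
        (α_ ((ext W X).obj f) ((ext X Y).obj g) ((ext Y Z).obj h)).inv =
      (ext W Z).map (f ◁ (mu h g).hom) ≫
        (ext W Z).map (α_ f ((ext X Y).obj g) ((ext Y Z).obj h)).inv ≫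
        (mu h (f ≫ (ext X Y).obj g)).hom ≫ (mu g f).hom ▷ (ext Y Z).obj h
  unitality {X Y : A} (f : J.obj X ⟶ obj Y) :
    (ext X Y).map (eta f).hom ≫ (mu f (unit X)).hom ≫ (theta X).hom ▷ (ext X Y).obj f =
      (λ_ ((ext X Y).obj f)).inv

namespace RelativePseudomonad

variable {A : Type u₁} [Bicategory.{w₁, v₁} A] {E : Type u₂} [Bicategory.{w₂, v₂} E] {J : A ⥤ᵖ E}

/-- A pseudoalgebra for a relative pseudomonad. -/
structure Pseudoalgebra (T : RelativePseudomonad J) where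
  /-- the underlying object -/
  carrier : E
  /-- the extension operator `f ↦ f^a` -/
  ext (X : A) : (J.obj X ⟶ carrier) ⥤ (T.obj X ⟶ carrier)
  /-- `â_{g,f} : (g^a f)^a ≅ g^a f^*` -/
  hat {X Y : A} (g : J.obj Y ⟶ carrier) (f : J.obj X ⟶ T.obj Y) :
    (ext X).obj (f ≫ (ext Y).obj g) ≅ (T.ext X Y).obj f ≫ (ext Y).obj g
  hat_naturality_left {X Y : A} {g g' : J.obj Y ⟶ carrier} (γ : g ⟶ g')
      (f : J.obj X ⟶ T.obj Y) :
    (ext X).map (f ◁ (ext Y).map γ) ≫ (hat g' f).hom =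
      (hat g f).hom ≫ (T.ext X Y).obj f ◁ (ext Y).map γ
  hat_naturality_right {X Y : A} (g : J.obj Y ⟶ carrier) {f f' : J.obj X ⟶ T.obj Y}
      (φ : f ⟶ f') :
    (ext X).map (φ ▷ (ext Y).obj g) ≫ (hat g f').hom =
      (hat g f).hom ≫ (T.ext X Y).map φ ▷ (ext Y).obj g
  /-- `ã_f : f ≅ f^a i_X` -/
  tilde {X : A} (f : J.obj X ⟶ carrier) : f ≅ T.unit X ≫ (ext X).obj f
  tilde_naturality {X : A} {f f' : J.obj X ⟶ carrier} (φ : f ⟶ f') :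
    φ ≫ (tilde f').hom = (tilde f).hom ≫ T.unit X ◁ (ext X).map φ
  associativity {X Y Z : A} (f : J.obj X ⟶ T.obj Y) (g : J.obj Y ⟶ T.obj Z)
      (h : J.obj Z ⟶ carrier) :
    (hat (g ≫ (ext Z).obj h) f).hom ≫ (T.ext X Y).obj f ◁ (hat h g).hom ≫
        (α_ ((T.ext X Y).obj f) ((T.ext Y Z).obj g) ((ext Z).obj h)).inv =
      (ext X).map (f ◁ (hat h g).hom) ≫
        (ext X).map (α_ f ((T.ext Y Z).obj g) ((ext Z).obj h)).inv ≫
        (hat h (f ≫ (T.ext Y Z).obj g)).hom ≫ (T.mu g f).hom ▷ (ext Z).obj h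
  unitality {X : A} (f : J.obj X ⟶ carrier) :
    (ext X).map (tilde f).hom ≫ (hat f (T.unit X)).hom ≫ (T.theta X).hom ▷ (ext X).obj f =
      (λ_ ((ext X).obj f)).inv

/-- A lax morphism of pseudoalgebras. -/
structure LaxMorphism {T : RelativePseudomonad J} (a b : T.Pseudoalgebra) where
  /-- the underlying 1-cell `h` -/
  hom : a.carrier ⟶ b.carrier
  /-- `h̄_f : (h f)^b ⟶ h f^a` -/
  bar {X : A} (f : J.obj X ⟶ a.carrier) : (b.ext X).obj (f ≫ hom) ⟶ (a.ext X).obj f ≫ hom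
  bar_naturality {X : A} {f f' : J.obj X ⟶ a.carrier} (φ : f ⟶ f') :
    (b.ext X).map (φ ▷ hom) ≫ bar f' = bar f ≫ (a.ext X).map φ ▷ hom
  associativity {X Y : A} (f : J.obj X ⟶ T.obj Y) (g : J.obj Y ⟶ a.carrier) :
    (b.hat (g ≫ hom) f).hom ≫ (T.ext X Y).obj f ◁ bar g ≫
        (α_ ((T.ext X Y).obj f) ((a.ext Y).obj g) hom).inv =
      (b.ext X).map (f ◁ bar g) ≫ (b.ext X).map (α_ f ((a.ext Y).obj g) hom).inv ≫
        bar (f ≫ (a.ext Y).obj g) ≫ (a.hat g f).hom ▷ hom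
  unitality {X : A} (f : J.obj X ⟶ a.carrier) :
    (b.tilde (f ≫ hom)).hom ≫ T.unit X ◁ bar f ≫ (α_ (T.unit X) ((a.ext X).obj f) hom).inv =
      (a.tilde f).hom ▷ hom

/-- A pseudomorphism is a lax morphism all of whose structure 2-cells are invertible. -/
def LaxMorphism.IsPseudomorphism {T : RelativePseudomonad J} {a b : T.Pseudoalgebra}
    (h : LaxMorphism a b) : Prop :=
  ∀ (X : A) (f : J.obj X ⟶ a.carrier), IsIso (h.bar f)

/-- A pseudoalgebra is lax-idempotent if, for each `X`, the 2-cells `ã_f` are the components of the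
unit of an adjunction between the extension operator and precomposition with `i_X`. -/
def Pseudoalgebra.IsLaxIdempotent {T : RelativePseudomonad J} (a : T.Pseudoalgebra) : Prop :=
  ∀ X : A, ∃ adj : a.ext X ⊣ precomp a.carrier (T.unit X),
    ∀ f : J.obj X ⟶ a.carrier, adj.unit.app f = (a.tilde f).hom

/-- The restriction of a `J`-relative pseudomonad along a pseudofunctor into the domain of `J`. -/
def restrict (T : RelativePseudomonad J) {A' : Type u₃} [Bicategory.{w₃, v₃} A'] (K : A' ⥤ᵖ A) :
    RelativePseudomonad (K.comp J) where
  obj X := T.obj (K.obj X)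
  ext X Y := T.ext (K.obj X) (K.obj Y)
  unit X := T.unit (K.obj X)
  mu g f := T.mu g f
  mu_naturality_left γ f := T.mu_naturality_left γ f
  mu_naturality_right g _ _ φ := T.mu_naturality_right g φ
  eta f := T.eta f
  eta_naturality φ := T.eta_naturality φ
  theta X := T.theta (K.obj X)
  associativity f g h := T.associativity f g h
  unitality f := T.unitality f

end RelativePseudomonad

section LeftExtensions

variable {E : Type u₂} [Bicategory.{w₂, v₂} E]

/-- The 2-cell `η` exhibits `e` as a left extension of `f` along `i`. -/
def ExhibitsLeftExtension {X Y Z : E} (i : X ⟶ Y) {f : X ⟶ Z} {e : Y ⟶ Z}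
    (η : f ⟶ i ≫ e) : Prop :=
  ∀ (k : Y ⟶ Z) (β : f ⟶ i ≫ k), ∃! γ : e ⟶ k, η ≫ i ◁ γ = β

namespace ExhibitsLeftExtension

variable {X Y Z : E} {i : X ⟶ Y} {f : X ⟶ Z} {e : Y ⟶ Z} {η : f ⟶ i ≫ e}

/-- The 2-cell out of a left extension induced by its universal property. -/
noncomputable def desc (hη : ExhibitsLeftExtension i η) {k : Y ⟶ Z} (β : f ⟶ i ≫ k) : e ⟶ k :=
  (hη k β).choose

lemma fac (hη : ExhibitsLeftExtension i η) {k : Y ⟶ Z} (β : f ⟶ i ≫ k) :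
    η ≫ i ◁ hη.desc β = β :=
  (hη k β).choose_spec.1

lemma fac_assoc (hη : ExhibitsLeftExtension i η) {k : Y ⟶ Z} (β : f ⟶ i ≫ k) {l : X ⟶ Z}
    (δ : i ≫ k ⟶ l) : η ≫ i ◁ hη.desc β ≫ δ = β ≫ δ := by
  rw [← Category.assoc, fac]

lemma hom_ext (hη : ExhibitsLeftExtension i η) {k : Y ⟶ Z} {γ γ' : e ⟶ k}
    (h : η ≫ i ◁ γ = η ≫ i ◁ γ') : γ = γ' :=
  (hη k (η ≫ i ◁ γ')).unique h rfl

/-- Left extensions are unique up to unique isomorphism. -/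
@[simps]
noncomputable def uniqueUpToIso (hη : ExhibitsLeftExtension i η) {e' : Y ⟶ Z} {η' : f ⟶ i ≫ e'}
    (hη' : ExhibitsLeftExtension i η') : e ≅ e' where
  hom := hη.desc η'
  inv := hη'.desc η
  hom_inv_id := hη.hom_ext (by simp [fac_assoc, fac])
  inv_hom_id := hη'.hom_ext (by simp [fac_assoc, fac])

end ExhibitsLeftExtension

variable {A : Type u₁} [Bicategory.{w₁, v₁} A]

open ExhibitsLeftExtension in
/-- The relative pseudomonad whose extension operator is given by left extension along the unit;
its 2-cells `μ` and `θ` are the ones induced by the universal property of left extensions. -/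
noncomputable def RelativePseudomonad.ofLeftExtensions (J : A ⥤ᵖ E) (T : A → E)
    (i : ∀ X, J.obj X ⟶ T X)
    (e : ∀ {X Y : A}, (J.obj X ⟶ T Y) → (T X ⟶ T Y))
    (η : ∀ {X Y : A} (f : J.obj X ⟶ T Y), f ≅ i X ≫ e f)
    (hη : ∀ {X Y : A} (f : J.obj X ⟶ T Y), ExhibitsLeftExtension (i X) (η f).hom)
    (hcomp : ∀ {X Y Z : A} (g : J.obj Y ⟶ T Z) (f : J.obj X ⟶ T Y),
      ExhibitsLeftExtension (i X) ((η f).hom ▷ e g ≫ (α_ (i X) (e f) (e g)).hom))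
    (hid : ∀ X : A, ExhibitsLeftExtension (i X) (ρ_ (i X)).inv) :
    RelativePseudomonad J where
  obj := T
  ext X Y :=
    { obj := fun (f : J.obj X ⟶ T Y) => e f
      map := fun {f f' : J.obj X ⟶ T Y} φ => (hη f).desc (φ ≫ (η f').hom)
      map_id := fun f => (hη f).hom_ext (by simp [fac])
      map_comp := fun φ ψ => (hη _).hom_ext (by simp [fac, fac_assoc]) }
  unit := i
  mu {X Y Z} g f := (hη (f ≫ e g)).uniqueUpToIso (hcomp g f)
  mu_naturality_left {X Y Z g g'} γ f := by
    refine (hη _).hom_ext ?_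
    dsimp only
    simp only [Bicategory.whiskerLeft_comp, uniqueUpToIso_hom, fac_assoc, fac, Category.assoc]
    rw [← associator_naturality_right, whisker_exchange_assoc]
  mu_naturality_right {X Y Z} g f f' φ := by
    refine (hη _).hom_ext ?_
    dsimp only
    simp only [Bicategory.whiskerLeft_comp, uniqueUpToIso_hom, fac_assoc, fac, Category.assoc]
    rw [← associator_naturality_middle, ← comp_whiskerRight_assoc, ← comp_whiskerRight_assoc, fac]
  eta f := η f
  eta_naturality φ := (fac _ _).symm
  theta X := (hη (i X)).uniqueUpToIso (hid X)
  associativity {W X Y Z} f g h := by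
    refine (hη _).hom_ext ?_
    dsimp only
    simp [fac_assoc]
    rw [← associator_naturality_right_assoc, ← whisker_exchange_assoc,
      ← associator_naturality_middle, ← comp_whiskerRight_assoc, fac]
    simp
  unitality {X Y} f := by
    refine (hη _).hom_ext ?_
    dsimp only
    simp [fac_assoc]
    rw [← associator_naturality_middle, ← comp_whiskerRight_assoc, fac]
    simp

end LeftExtensions

section Cocompletion

attribute [local instance] uliftCategory

/-- A category is `Φ`-cocomplete if it admits all colimits of shape `D`, for each `D` in `Φ`. -/
def IsCocompleteFor (Φ : ObjectProperty Cat.{v, v}) (C : Type u₁) [Category.{v₁} C] : Prop :=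
  ∀ D : Cat.{v, v}, Φ D → HasColimitsOfShape D C

/-- A functor is `Φ`-cocontinuous if it preserves all colimits of shape `D`, for each `D` in
`Φ`. -/
def IsCocontinuousFor (Φ : ObjectProperty Cat.{v, v}) {C : Type u₁} [Category.{v₁} C]
    {C' : Type u₂} [Category.{v₂} C'] (F : C ⥤ C') : Prop :=
  ∀ D : Cat.{v, v}, Φ D → PreservesColimitsOfShape D F

lemma IsCocontinuousFor.of_iso {Φ : ObjectProperty Cat.{v, v}} {C : Type u₁} [Category.{v₁} C]
    {C' : Type u₂} [Category.{v₂} C'] {F G : C ⥤ C'} (hF : IsCocontinuousFor Φ F) (e : F ≅ G) :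
    IsCocontinuousFor Φ G := fun D hD =>
  have := hF D hD
  preservesColimitsOfShape_of_natIso e

lemma IsCocontinuousFor.comp {Φ : ObjectProperty Cat.{v, v}} {C : Type u₁} [Category.{v₁} C]
    {C' : Type u₂} [Category.{v₂} C'] {C'' : Type u₃} [Category.{v₃} C''] {F : C ⥤ C'}
    {G : C' ⥤ C''} (hF : IsCocontinuousFor Φ F) (hG : IsCocontinuousFor Φ G) :
    IsCocontinuousFor Φ (F ⋙ G) := fun D hD =>
  have := hF D hD
  have := hG D hD
  inferInstance

/-- The inclusion of the 2-category of small categories into the 2-category of locally small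
categories. -/
def smallInclusion : StrictPseudofunctor Cat.{v, v} Cat.{v, v + 1} := StrictPseudofunctor.mk''
  { obj X := Cat.of (ULift.{v + 1} X)
    map F := (ULift.downFunctor ⋙ F.toFunctor ⋙ ULift.upFunctor).toCatHom
    map₂ α := (Functor.whiskerLeft ULift.downFunctor
      (Functor.whiskerRight α.toNatTrans ULift.upFunctor)).toCatHom₂ 
    map_id X := rfl
    map_comp F G := rfl
    map₂_whisker_left f _ _ η := by
      ext x
      exact ((Category.id_comp _).trans (Category.comp_id _)).symm }

/-- The full sub-2-category of small categories on a class of small categories. -/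
abbrev FullSub (Φ : ObjectProperty Cat.{v, v}) : Type (v + 1) :=
  InducedBicategory Cat.{v, v} (fun X : Subtype Φ => X.1)

/-- The inclusion of a class of small categories into the small categories. -/
def fullSubInclusion (Φ : ObjectProperty Cat.{v, v}) : FullSub Φ ⥤ᵖ Cat.{v, v} :=
  (InducedBicategory.forget (C := Cat.{v, v}) (F := fun X : Subtype Φ => X.1)).toPseudofunctor

variable (Φ : ObjectProperty Cat.{v, v})

/-- The presheaves on `X` that lie in the closure of the representables under `Φ`-colimits. -/
abbrev cocompletionProp (X : Type v) [Category.{v} X] : ObjectProperty (Xᵒᵖ ⥤ Type v) :=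
  (ObjectProperty.ofObj (yoneda (C := X)).obj).colimitsClosure
    (fun D : Subtype Φ => (D.1 : Type v))

/-- The free `Φ`-cocompletion of a small category `X`. -/
abbrev Cocompletion (X : Type v) [Category.{v} X] : Type (v + 1) :=
  (cocompletionProp Φ X).FullSubcategory

/-- The Yoneda embedding of a small category into its free `Φ`-cocompletion. -/
def cocompletionUnit (X : Type v) [Category.{v} X] : ULift.{v + 1} X ⥤ Cocompletion Φ X :=
  ULift.downFunctor ⋙ (cocompletionProp Φ X).lift yoneda
    (fun x => ObjectProperty.le_colimitsClosure _ _ _ (ObjectProperty.ofObj_apply _ x))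

instance (X : Type v) [Category.{v} X] : (cocompletionUnit Φ X).Full := by
  have : (ULift.downFunctor : ULift.{v + 1} X ⥤ X).Full := ULift.equivalence.symm.full_functor
  unfold cocompletionUnit
  infer_instance

variable {Φ}


section

variable {X : Type v} [Category.{v} X]

lemma exists_lift_of_isColimit {D : Type v} [Category.{v} D] {K : D ⥤ Cocompletion Φ X}
    {c : Cocone K} (hc : IsColimit ((cocompletionProp Φ X).ι.mapCocone c)) (x : ULift.{v + 1} X)
    (t : (cocompletionUnit Φ X).obj x ⟶ c.pt) :
    ∃ (d : D) (t' : (cocompletionUnit Φ X).obj x ⟶ K.obj d), t = t' ≫ c.ι.app d := by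
  obtain ⟨d, y, hy⟩ := Types.jointly_surjective_of_isColimit
    (isColimitOfPreserves ((evaluation Xᵒᵖ (Type v)).obj (Opposite.op x.down)) hc)
    (yonedaEquiv (F := c.pt.obj) t.hom)
  let y' : (K.obj d).obj.obj (Opposite.op x.down) := y
  refine ⟨d, ObjectProperty.homMk (yonedaEquiv.symm y'), ?_⟩
  apply ObjectProperty.hom_ext
  apply (yonedaEquiv (X := x.down) (F := c.pt.obj)).injective
  refine hy.symm.trans ?_
  exact ((yonedaEquiv_comp (yonedaEquiv.symm y') (c.ι.app d).hom).trans
    (congrArg _ (yonedaEquiv.apply_symm_apply y'))).symm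

/-- A `Φ`-cocontinuous functor out of the free `Φ`-cocompletion is pointwise the left extension of
its restriction to the representables. -/
lemma cocompletion_existsUnique {Z : Type u₁} [Category.{v₁} Z] {H : Cocompletion Φ X ⥤ Z}
    (hH : IsCocontinuousFor Φ H) (P : Cocompletion Φ X) (z : Z)
    (s : ∀ x, ((cocompletionUnit Φ X).obj x ⟶ P) → (H.obj ((cocompletionUnit Φ X).obj x) ⟶ z))
    (hs : ∀ {x x'} (f : x ⟶ x') (t : (cocompletionUnit Φ X).obj x' ⟶ P),
      H.map ((cocompletionUnit Φ X).map f) ≫ s x' t = s x ((cocompletionUnit Φ X).map f ≫ t)) :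
    ∃! m : H.obj P ⟶ z, ∀ x t, H.map t ≫ m = s x t := by
  obtain ⟨P, hP⟩ := P
  induction hP generalizing z with
  | of_mem P hP =>
    obtain ⟨x₀⟩ := hP
    let t₀ : (cocompletionUnit Φ X).obj ⟨x₀⟩ ⟶ ⟨yoneda.obj x₀, .of_mem _ ⟨x₀⟩⟩ := 𝟙 _
    refine ⟨s ⟨x₀⟩ t₀, fun x t => ?_, fun m hm => ?_⟩
    · obtain ⟨f, rfl⟩ := (cocompletionUnit Φ X).map_surjective (X := x) (Y := ⟨x₀⟩) t
      exact (hs f t₀).trans (congrArg (s x) (Category.comp_id _))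
    · refine Eq.trans ?_ (hm ⟨x₀⟩ t₀)
      rw [show H.map t₀ = 𝟙 _ from H.map_id _]
      exact (Category.id_comp m).symm
  | @of_isoClosure P Q e hP ih =>
    let e' : (⟨P, hP⟩ : Cocompletion Φ X) ≅ ⟨Q, .of_isoClosure e hP⟩ :=
      (cocompletionProp Φ X).isoMk e
    obtain ⟨m, hm, hm'⟩ := ih z (fun x t => s x (t ≫ e'.hom)) (fun f t => by
      rw [hs, Category.assoc])
    refine ⟨H.map e'.inv ≫ m, fun x t => ?_, fun m' h' => ?_⟩
    · rw [← H.map_comp_assoc]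
      exact (hm x (t ≫ e'.inv)).trans (by simp)
    · rw [← hm' (H.map e'.hom ≫ m') (fun x t => by
        rw [← h', H.map_comp_assoc]), ← H.map_comp_assoc]
      simp
  | @of_colimitPresentation P D pres h ih =>
    let K : D.1 ⥤ Cocompletion Φ X := (cocompletionProp Φ X).lift pres.diag h
    let c : Cocone K :=
      { pt := ⟨P, .of_colimitPresentation pres h⟩
        ι := { app d := ObjectProperty.homMk (pres.ι.app d)
               naturality d d' f := by ext : 1; exact pres.ι.naturality f } }
    have hc' : IsColimit ((cocompletionProp Φ X).ι.mapCocone c) := pres.isColimit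
    have hc : IsColimit c := isColimitOfReflects _ hc'
    have := hH D.1 D.2
    have hHc := isColimitOfPreserves H hc
    have ih' (d : D.1) : ∃! m : H.obj (K.obj d) ⟶ z, ∀ x t, H.map t ≫ m = s x (t ≫ c.ι.app d) :=
      ih d z (fun x t => s x (t ≫ c.ι.app d)) (fun f t => by rw [hs, Category.assoc])
    choose m hm hm' using ih'
    have hm₂ {d d' : D.1} (f : d ⟶ d') : H.map (K.map f) ≫ m d' = m d :=
      hm' d _ (fun x t => by
        rw [← H.map_comp_assoc, hm, Category.assoc, c.w])
    let cm : Cocone (K ⋙ H) :=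
      { pt := z
        ι := { app d := m d
               naturality d d' f := (hm₂ f).trans (Category.comp_id _).symm } }
    refine ⟨hHc.desc cm, fun x t => ?_, fun m' h' => hHc.hom_ext (fun d => ?_)⟩
    · obtain ⟨d, t', rfl⟩ := exists_lift_of_isColimit hc' x t
      rw [H.map_comp, Category.assoc]
      exact (congrArg (H.map t' ≫ ·) (hHc.fac cm d)).trans (hm d x t')
    · rw [hHc.fac]
      exact hm' d _ (fun x t => by
        rw [← h']
        exact (H.map_comp_assoc _ _ _).symm)

lemma cocompletion_isLeftKanExtension {Z : Type u₁} [Category.{v₁} Z]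
    {H : Cocompletion Φ X ⥤ Z} (hH : IsCocontinuousFor Φ H) {F : ULift.{v + 1} X ⥤ Z}
    (α : F ⟶ cocompletionUnit Φ X ⋙ H) [IsIso α] : H.IsLeftKanExtension α := by
  have key (G : Cocompletion Φ X ⥤ Z) (β : F ⟶ cocompletionUnit Φ X ⋙ G)
      (P : Cocompletion Φ X) :=
    cocompletion_existsUnique hH P (G.obj P) (fun x t => (inv α).app x ≫ β.app x ≫ G.map t)
      (fun {x x'} f t => by
        have h₁ := (inv α).naturality f
        have h₂ := β.naturality f
        dsimp at h₁ h₂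
        rw [reassoc_of% h₁, reassoc_of% h₂, G.map_comp])
  choose m hm hm' using key
  have fac (G : Cocompletion Φ X ⥤ Z) (β : F ⟶ cocompletionUnit Φ X ⋙ G) (x) :
      α.app x ≫ m G β ((cocompletionUnit Φ X).obj x) = β.app x := by
    have h := hm G β ((cocompletionUnit Φ X).obj x) x (𝟙 _)
    rw [H.map_id, G.map_id] at h
    have h' : m G β ((cocompletionUnit Φ X).obj x) = (inv α).app x ≫ β.app x :=
      (Category.id_comp _).symm.trans (h.trans (congrArg _ (Category.comp_id _)))
    rw [h', ← NatTrans.comp_app_assoc, IsIso.hom_inv_id]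
    exact Category.id_comp _
  let γ (G : Cocompletion Φ X ⥤ Z) (β : F ⟶ cocompletionUnit Φ X ⋙ G) : H ⟶ G :=
    { app := m G β
      naturality P Q u := by
        obtain ⟨n, -, hn⟩ := cocompletion_existsUnique hH P (G.obj Q)
          (fun x t => (inv α).app x ≫ β.app x ≫ G.map (t ≫ u)) (fun {x x'} f t => by
            have h₁ := (inv α).naturality f
            have h₂ := β.naturality f
            dsimp at h₁ h₂
            rw [reassoc_of% h₁, reassoc_of% h₂, ← G.map_comp, Category.assoc])
        rw [hn (H.map u ≫ m G β Q) (fun x t => by rw [← H.map_comp_assoc, hm]),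
          hn (m G β P ≫ G.map u) (fun x t => by
            rw [← Category.assoc, hm, G.map_comp, Category.assoc, Category.assoc])] }
  refine ⟨⟨IsInitial.ofUniqueHom
    (fun E => StructuredArrow.homMk (γ E.right E.hom) ?_) (fun E u => ?_)⟩⟩
  · ext x
    exact fac E.right E.hom x
  · apply StructuredArrow.hom_ext
    ext P
    refine hm' E.right E.hom P _ (fun x t => ?_)
    let w : H ⟶ E.right := u.right
    have h : α.app x ≫ w.app ((cocompletionUnit Φ X).obj x) = E.hom.app x :=
      NatTrans.congr_app (StructuredArrow.w u) x
    have hi : (inv α).app x ≫ α.app x = 𝟙 _ := by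
      rw [← NatTrans.comp_app, IsIso.inv_hom_id, NatTrans.id_app]
    have hw := w.naturality t
    rw [← h, Category.assoc, reassoc_of% hi]
    exact hw

lemma cocompletion_ι_isCocontinuousFor : IsCocontinuousFor Φ (cocompletionProp Φ X).ι := by
  intro D hD
  have : (cocompletionProp Φ X).IsClosedUnderColimitsOfShape D :=
    inferInstanceAs ((cocompletionProp Φ X).IsClosedUnderColimitsOfShape
      ((⟨D, hD⟩ : Subtype Φ).1 : Type v))
  infer_instance

variable {Y : Type v} [Category.{v} Y]

lemma exists_extension (F : ULift.{v + 1} X ⥤ Cocompletion Φ Y) :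
    ∃ H : Cocompletion Φ X ⥤ Cocompletion Φ Y, IsCocontinuousFor Φ H ∧
      Nonempty (F ≅ cocompletionUnit Φ X ⋙ H) := by
  let A : X ⥤ (Yᵒᵖ ⥤ Type v) := ULift.upFunctor ⋙ F ⋙ (cocompletionProp Φ Y).ι
  let L : (Xᵒᵖ ⥤ Type v) ⥤ (Yᵒᵖ ⥤ Type v) := uliftYoneda.{v}.leftKanExtension A
  let e₁ : uliftYoneda.{v} ≅ (yoneda : X ⥤ Xᵒᵖ ⥤ Type v) := uliftYonedaIsoYoneda.{v}
  have : IsIso (uliftYoneda.{v}.leftKanExtensionUnit A) :=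
    Presheaf.isIso_of_isLeftKanExtension.{v, v, v, v, v + 1} _ _
  let e₂ : A ≅ uliftYoneda.{v} ⋙ L := asIso (uliftYoneda.{v}.leftKanExtensionUnit A)
  let e : A ≅ yoneda ⋙ L := e₂ ≪≫ Functor.isoWhiskerRight e₁ L
  have hL : PreservesColimitsOfSize.{v, v} L :=
    Presheaf.preservesColimitsOfSize_leftKanExtension.{v, v, v, v, v, v + 1, v} A
  have hP : cocompletionProp Φ X ≤ (cocompletionProp Φ Y).inverseImage L := by
    refine @ObjectProperty.colimitsClosure_le _ _ _ _ _ _ _ inferInstance (fun D => ?_) ?_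
    · infer_instance
    · rintro _ ⟨x⟩
      exact (cocompletionProp Φ Y).prop_of_iso (e.app x) (F.obj ⟨x⟩).property
  let H : Cocompletion Φ X ⥤ Cocompletion Φ Y :=
    (cocompletionProp Φ Y).lift ((cocompletionProp Φ X).ι ⋙ L) (fun P => hP _ P.property)
  refine ⟨H, fun D hD => ?_, ⟨?_⟩⟩
  · have := cocompletion_ι_isCocontinuousFor (Φ := Φ) (X := X) D hD
    have : PreservesColimitsOfShape D (H ⋙ (cocompletionProp Φ Y).ι) :=
      inferInstanceAs (PreservesColimitsOfShape D ((cocompletionProp Φ X).ι ⋙ L))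
    exact preservesColimitsOfShape_of_reflects_of_preserves H (cocompletionProp Φ Y).ι
  · exact Functor.fullyFaithfulCancelRight (cocompletionProp Φ Y).ι
      (Functor.isoWhiskerLeft ULift.downFunctor e)

instance (F : ULift.{v + 1} X ⥤ Cocompletion Φ Y) :
    (cocompletionUnit Φ X).HasLeftKanExtension F := by
  obtain ⟨H, hH, ⟨e⟩⟩ := exists_extension F
  have := cocompletion_isLeftKanExtension hH e.hom
  exact Functor.HasLeftKanExtension.mk H e.hom

instance (F : ULift.{v + 1} X ⥤ Cocompletion Φ Y) :
    IsIso ((cocompletionUnit Φ X).leftKanExtensionUnit F) := by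
  obtain ⟨H, hH, ⟨e⟩⟩ := exists_extension F
  have := cocompletion_isLeftKanExtension hH e.hom
  let u := Functor.leftKanExtensionUnique ((cocompletionUnit Φ X).leftKanExtension F)
    ((cocompletionUnit Φ X).leftKanExtensionUnit F) H e.hom
  have h : (cocompletionUnit Φ X).leftKanExtensionUnit F =
      e.hom ≫ Functor.whiskerLeft (cocompletionUnit Φ X) u.inv := by
    simp [u]
  rw [h]
  infer_instance

/-- The unit of a left extension along the unit of the free `Φ`-cocompletion, as an isomorphism. -/
noncomputable def leftKanExtensionUnitIso (F : ULift.{v + 1} X ⥤ Cocompletion Φ Y) :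
    F ≅ cocompletionUnit Φ X ⋙ (cocompletionUnit Φ X).leftKanExtension F :=
  asIso ((cocompletionUnit Φ X).leftKanExtensionUnit F)

lemma leftKanExtension_isCocontinuousFor (F : ULift.{v + 1} X ⥤ Cocompletion Φ Y) :
    IsCocontinuousFor Φ ((cocompletionUnit Φ X).leftKanExtension F) := by
  obtain ⟨H, hH, ⟨e⟩⟩ := exists_extension F
  have := cocompletion_isLeftKanExtension hH e.hom
  exact hH.of_iso (Functor.leftKanExtensionUnique H e.hom
    ((cocompletionUnit Φ X).leftKanExtension F) ((cocompletionUnit Φ X).leftKanExtensionUnit F))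

end

lemma exhibitsLeftExtension_of_isLeftKanExtension {C C' C'' : Cat.{v₁, u₁}} (i : C ⟶ C')
    {f : C ⟶ C''} {e : C' ⟶ C''} (η : f ⟶ i ≫ e)
    (h : Functor.IsLeftKanExtension (L := i.toFunctor) e.toFunctor η.toNatTrans) :
    ExhibitsLeftExtension i η := by
  intro k β
  refine ⟨Cat.Hom₂.ofNatTrans (Functor.descOfIsLeftKanExtension (L := i.toFunctor) e.toFunctor
    η.toNatTrans k.toFunctor β.toNatTrans), ?_, fun γ hγ => ?_⟩
  · apply Cat.Hom₂.ext
    exact Functor.descOfIsLeftKanExtension_fac (L := i.toFunctor) e.toFunctor η.toNatTrans _ _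
  · apply Cat.Hom₂.ext
    apply Functor.hom_ext_of_isLeftKanExtension (L := i.toFunctor) e.toFunctor η.toNatTrans
    rw [Functor.descOfIsLeftKanExtension_fac (L := i.toFunctor)]
    exact congrArg Cat.Hom₂.toNatTrans hγ

variable (Φ)

/-- The left extension of `f : X ⥤ Φ̄ Y` along the unit `X ⥤ Φ̄ X`. -/
noncomputable def cocompletionExt {X Y : Cat.{v, v}}
    (f : smallInclusion.toPseudofunctor.obj X ⟶ Cat.of (Cocompletion Φ Y)) :
    Cat.of (Cocompletion Φ X) ⟶ Cat.of (Cocompletion Φ Y) :=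
  let F : ULift.{v + 1} X ⥤ Cocompletion Φ Y := f.toFunctor
  ((cocompletionUnit Φ X).leftKanExtension F).toCatHom

/-- The unit of the left extension of `f : X ⥤ Φ̄ Y` along the unit `X ⥤ Φ̄ X`. -/
noncomputable def cocompletionEta {X Y : Cat.{v, v}}
    (f : smallInclusion.toPseudofunctor.obj X ⟶ Cat.of (Cocompletion Φ Y)) :
    f ≅ (cocompletionUnit Φ X).toCatHom ≫ cocompletionExt Φ f :=
  let F : ULift.{v + 1} X ⥤ Cocompletion Φ Y := f.toFunctor
  Cat.Hom.isoMk (leftKanExtensionUnitIso F)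

/-- The relative pseudomonad of the free `Φ`-cocompletion of small categories: it sends a small
category `X` to its free `Φ`-cocompletion, the unit is the Yoneda embedding and the extension
operator is left extension along the unit. -/
noncomputable def cocompletion :
    RelativePseudomonad smallInclusion.{v}.toPseudofunctor :=
  RelativePseudomonad.ofLeftExtensions smallInclusion.{v}.toPseudofunctor
    (fun X => Cat.of (Cocompletion Φ X))
    (fun X => (cocompletionUnit Φ X).toCatHom)
    (cocompletionExt Φ)
    (cocompletionEta Φ)
    (fun {X Y} f => by
      let F : ULift.{v + 1} X ⥤ Cocompletion Φ Y := f.toFunctor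
      have h : ((cocompletionUnit Φ X).leftKanExtension F).IsLeftKanExtension
        ((cocompletionUnit Φ X).leftKanExtensionUnit F) := inferInstance
      exact exhibitsLeftExtension_of_isLeftKanExtension _ _ h)
    (fun {X Y Z} g f => by
      let F : ULift.{v + 1} X ⥤ Cocompletion Φ Y := f.toFunctor
      let G : ULift.{v + 1} Y ⥤ Cocompletion Φ Z := g.toFunctor
      exact exhibitsLeftExtension_of_isLeftKanExtension _ _
        (cocompletion_isLeftKanExtension
          ((leftKanExtension_isCocontinuousFor F).comp (leftKanExtension_isCocontinuousFor G))
          (Functor.whiskerRight (leftKanExtensionUnitIso F).hom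
            ((cocompletionUnit Φ Y).leftKanExtension G) ≫ (Functor.associator _ _ _).hom)))
    (fun X => exhibitsLeftExtension_of_isLeftKanExtension _ _
      (cocompletion_isLeftKanExtension (H := 𝟭 (Cocompletion Φ X))
        (fun _ _ => inferInstance) (cocompletionUnit Φ X).rightUnitor.inv))

/-- The free `Φ`-cocompletion relative pseudomonad restricted to a class `Φ'` of small
categories. -/
noncomputable def cocompletionOn (Φ' : ObjectProperty Cat.{v, v}) :
    RelativePseudomonad ((fullSubInclusion Φ').comp smallInclusion.{v}.toPseudofunctor) :=
  (cocompletion Φ).restrict (fullSubInclusion Φ')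

end Cocompletion

/-! Let `P` be the terminal presheaf on `D ∈ Φ`. It is the `D`-shaped colimit of the representables,
so it lies in `Φ̄(D)`. For `k : D ⥤ A` in a pseudoalgebra, `k^a P` is a colimit of `k`, with legs `k
x ≅ k^a (y x) ⟶ k^a P` (`isColimitExtCocone`).

Existence of descents uses `j : D ⥤ D_⊤`. A cocone with vertex `z` is a 2-cell from `k` to the
restriction along `j` of the constant functor `z` on `D_⊤`. Extending it gives `k^a P ⟶ z^a ((i j)^*
P)`, and since `i ⊤` is terminal one continues to `z^a (i ⊤) ≅ z`. This composite is `extDesc`.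

For uniqueness, `extDesc` is natural in the vertex, so it suffices that the colimiting cocone
descends to the identity. That cocone is the image under `k^a` of the canonical cocone with vertex
`P` in `Φ̄(D)`, and `k^a` is a pseudomorphism out of a free pseudoalgebra. So the descent is `k^a`
of an endomorphism of the terminal object `P` (`extDesc_extMorphism`).

A pseudomorphism respects these colimits through its 2-cell at `k`, hence is `Φ`-cocontinuous. In
particular each `f^a` is `Φ`-cocontinuous, so by `cocompletion_isLeftKanExtension` it is the left
extension of its restriction to representables. This is lax-idempotency. -/

namespace RelativePseudomonad

variable {A : Type u₁} [Bicategory.{w₁, v₁} A] {E : Type u₂} [Bicategory.{w₂, v₂} E] {J : A ⥤ᵖ E}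
  {T : RelativePseudomonad J}

/-! ### Formal consequences of the pseudoalgebra axioms in a bicategory -/

namespace Pseudoalgebra

/-- Naturality of the invertible `tilde` recovers a 2-cell from its extension restricted along the
unit. -/
lemma ext_map_injective (a : T.Pseudoalgebra) {X : A} {f f' : J.obj X ⟶ a.carrier}
    {φ ψ : f ⟶ f'} (h : (a.ext X).map φ = (a.ext X).map ψ) : φ = ψ := by
  rw [← cancel_mono (a.tilde f').hom, a.tilde_naturality, a.tilde_naturality, h]

/-- The left unit law of a pseudoalgebra, which follows from the other axioms. -/
lemma tilde_comp_hat (a : T.Pseudoalgebra) {X Y : A} (g : J.obj Y ⟶ a.carrier)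
    (f : J.obj X ⟶ T.obj Y) :
    (a.tilde (f ≫ (a.ext Y).obj g)).hom ≫ T.unit X ◁ (a.hat g f).hom ≫
        (α_ (T.unit X) ((T.ext X Y).obj f) ((a.ext Y).obj g)).inv =
      (T.eta f).hom ▷ (a.ext Y).obj g := by
  apply a.ext_map_injective
  -- After composing with the invertible `hat`, `mu` and `theta`, the associativity law for `T.unit
  -- X`, `f`, `g` reduces the claim to the unit laws of `T` and of `a`.
  rw [← cancel_mono (a.hat g _).hom, a.hat_naturality_right,
    ← cancel_mono ((T.mu f (T.unit X)).hom ▷ (a.ext Y).obj g),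
    ← cancel_mono ((T.theta X).hom ▷ (T.ext X Y).obj f ▷ (a.ext Y).obj g)]
  simp only [Functor.map_comp, Category.assoc]
  have h := a.unitality (f ≫ (a.ext Y).obj g)
  rw [← reassoc_of% a.associativity, ← comp_whiskerRight, ← comp_whiskerRight, T.unitality f,
    ← associator_inv_naturality_left, whisker_exchange_assoc, reassoc_of% h]
  simp

/-- The free pseudoalgebra on an object. -/
def free (T : RelativePseudomonad J) (Z : A) : T.Pseudoalgebra where
  carrier := T.obj Z
  ext X := T.ext X Z
  hat g f := T.mu g f
  hat_naturality_left γ f := T.mu_naturality_left γ f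
  hat_naturality_right g _ _ φ := T.mu_naturality_right g φ
  tilde f := T.eta f
  tilde_naturality φ := T.eta_naturality φ
  associativity f g h := T.associativity f g h
  unitality f := T.unitality f

/-- The extension of `k` as a lax morphism out of the free pseudoalgebra. -/
def extMorphism (a : T.Pseudoalgebra) {Z : A} (k : J.obj Z ⟶ a.carrier) :
    LaxMorphism (free T Z) a where
  hom := (a.ext Z).obj k
  bar f := (a.hat k f).hom
  bar_naturality φ := a.hat_naturality_right k φ
  associativity f g := a.associativity f g k
  unitality f := a.tilde_comp_hat k f

lemma extMorphism_isPseudomorphism (a : T.Pseudoalgebra) {Z : A} (k : J.obj Z ⟶ a.carrier) :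
    (a.extMorphism k).IsPseudomorphism := fun _ f =>
  inferInstanceAs (IsIso (a.hat k f).hom)

/-- The comparison `(g j)^a ⟶ g^a (i j)^*`. -/
def extComp (a : T.Pseudoalgebra) {X Y : A} (j : J.obj X ⟶ J.obj Y) (g : J.obj Y ⟶ a.carrier) :
    (a.ext X).obj (j ≫ g) ⟶ (T.ext X Y).obj (j ≫ T.unit Y) ≫ (a.ext Y).obj g :=
  (a.ext X).map (j ◁ (a.tilde g).hom ≫ (α_ j (T.unit Y) ((a.ext Y).obj g)).inv) ≫
    (a.hat g (j ≫ T.unit Y)).hom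

lemma extComp_naturality (a : T.Pseudoalgebra) {X Y : A} (j : J.obj X ⟶ J.obj Y)
    {g g' : J.obj Y ⟶ a.carrier} (γ : g ⟶ g') :
    (a.ext X).map (j ◁ γ) ≫ a.extComp j g' =
      a.extComp j g ≫ (T.ext X Y).obj (j ≫ T.unit Y) ◁ (a.ext Y).map γ := by
  dsimp only [extComp]
  rw [Category.assoc, ← a.hat_naturality_left, ← Functor.map_comp_assoc, ← Functor.map_comp_assoc,
    ← whiskerLeft_comp_assoc, a.tilde_naturality]
  simp

/-- By the left unit law, the comparison becomes explicit on restriction along the unit; this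
computes `extDesc` on the legs of a cocone. -/
lemma tilde_comp_extComp (a : T.Pseudoalgebra) {X Y : A} (j : J.obj X ⟶ J.obj Y)
    (g : J.obj Y ⟶ a.carrier) :
    (a.tilde (j ≫ g)).hom ≫ T.unit X ◁ a.extComp j g ≫
        (α_ (T.unit X) ((T.ext X Y).obj (j ≫ T.unit Y)) ((a.ext Y).obj g)).inv =
      j ◁ (a.tilde g).hom ≫ (α_ j (T.unit Y) ((a.ext Y).obj g)).inv ≫
        (T.eta (j ≫ T.unit Y)).hom ▷ (a.ext Y).obj g := by
  dsimp only [extComp]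
  rw [whiskerLeft_comp_assoc, ← reassoc_of% a.tilde_naturality, a.tilde_comp_hat, Category.assoc]

end Pseudoalgebra

lemma LaxMorphism.bar_comp_extComp {a b : T.Pseudoalgebra} (h : LaxMorphism a b) {X Y : A}
    (j : J.obj X ⟶ J.obj Y) (g : J.obj Y ⟶ a.carrier) :
    (b.ext X).map (α_ j g h.hom).inv ≫ h.bar (j ≫ g) ≫ a.extComp j g ▷ h.hom =
      b.extComp j (g ≫ h.hom) ≫ (T.ext X Y).obj (j ≫ T.unit Y) ◁ h.bar g ≫
        (α_ ((T.ext X Y).obj (j ≫ T.unit Y)) ((a.ext Y).obj g) h.hom).inv := by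
  dsimp only [Pseudoalgebra.extComp]
  rw [Category.assoc, h.associativity, comp_whiskerRight, ← reassoc_of% h.bar_naturality,
    ← Functor.map_comp_assoc, ← Functor.map_comp_assoc, ← Functor.map_comp_assoc]
  -- What remains under `b.ext X` is the unit law of `h` at `g`, whiskered with `j`.
  congr 2
  rw [comp_whiskerRight, whisker_assoc, ← h.unitality]
  simp

end RelativePseudomonad

/-! ### Descent morphisms for pseudoalgebras in `Cat` -/

namespace RelativePseudomonad

variable {A : Type u₁} [Bicategory.{w₁, v₁} A] {J : A ⥤ᵖ Cat.{v₂, u₂}}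
  {T : RelativePseudomonad J}

namespace Pseudoalgebra

/-- The morphism `k^a P ⟶ g w` induced by a 2-cell `k ⟶ g j` and a morphism `(i j)^* P ⟶ i w`. -/
def extDesc (a : T.Pseudoalgebra) {X Y : A} {j : J.obj X ⟶ J.obj Y} {k : J.obj X ⟶ a.carrier}
    {g : J.obj Y ⟶ a.carrier} (κ : k ⟶ j ≫ g) {P : T.obj X} {w : J.obj Y}
    (q : ((T.ext X Y).obj (j ≫ T.unit Y)).toFunctor.obj P ⟶ (T.unit Y).toFunctor.obj w) :
    ((a.ext X).obj k).toFunctor.obj P ⟶ g.toFunctor.obj w :=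
  ((a.ext X).map κ).toNatTrans.app P ≫ (a.extComp j g).toNatTrans.app P ≫
    ((a.ext Y).obj g).toFunctor.map q ≫ (a.tilde g).inv.toNatTrans.app w

lemma map_comp_extDesc (a : T.Pseudoalgebra) {X Y : A} {j : J.obj X ⟶ J.obj Y}
    {k k' : J.obj X ⟶ a.carrier} {g : J.obj Y ⟶ a.carrier} (φ : k ⟶ k') (κ : k' ⟶ j ≫ g)
    {P : T.obj X} {w : J.obj Y}
    (q : ((T.ext X Y).obj (j ≫ T.unit Y)).toFunctor.obj P ⟶ (T.unit Y).toFunctor.obj w) :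
    ((a.ext X).map φ).toNatTrans.app P ≫ a.extDesc κ q = a.extDesc (φ ≫ κ) q := by
  simp [extDesc]

/-- Every factor of `extDesc` is natural in `g`. For constant `g` this is naturality in the vertex
of a cocone, which drives the uniqueness of descents. -/
lemma extDesc_comp (a : T.Pseudoalgebra) {X Y : A} {j : J.obj X ⟶ J.obj Y}
    {k : J.obj X ⟶ a.carrier} {g g' : J.obj Y ⟶ a.carrier} (κ : k ⟶ j ≫ g) (γ : g ⟶ g')
    {P : T.obj X} {w : J.obj Y}
    (q : ((T.ext X Y).obj (j ≫ T.unit Y)).toFunctor.obj P ⟶ (T.unit Y).toFunctor.obj w) :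
    a.extDesc κ q ≫ γ.toNatTrans.app w = a.extDesc (κ ≫ j ◁ γ) q := by
  have h₁ : (a.tilde g).inv ≫ γ = T.unit Y ◁ (a.ext Y).map γ ≫ (a.tilde g').inv := by
    rw [Iso.inv_comp_eq, ← reassoc_of% a.tilde_naturality, Iso.hom_inv_id, Category.comp_id]
  have h₁' := congrArg (fun t => t.toNatTrans.app w) h₁
  have h₂ := congrArg (fun t => t.toNatTrans.app P) (a.extComp_naturality j γ)
  simp at h₁' h₂
  simp [extDesc, h₁', reassoc_of% h₂]

/-- The source of the factorisation of cocones: `hr` says that `q`, restricted along `p`, is the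
image of `r` under the unit. It is automatic when the unit sends `w` to a terminal object and `r` is
the map to a terminal `w`. -/
lemma tilde_comp_extDesc (a : T.Pseudoalgebra) {X Y : A} {j : J.obj X ⟶ J.obj Y}
    {k : J.obj X ⟶ a.carrier} {g : J.obj Y ⟶ a.carrier} (κ : k ⟶ j ≫ g) {P : T.obj X}
    {w : J.obj Y}
    (q : ((T.ext X Y).obj (j ≫ T.unit Y)).toFunctor.obj P ⟶ (T.unit Y).toFunctor.obj w)
    {x : J.obj X} (p : (T.unit X).toFunctor.obj x ⟶ P) (r : j.toFunctor.obj x ⟶ w)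
    (hr : (T.eta (j ≫ T.unit Y)).hom.toNatTrans.app x ≫
      ((T.ext X Y).obj (j ≫ T.unit Y)).toFunctor.map p ≫ q = (T.unit Y).toFunctor.map r) :
    (a.tilde k).hom.toNatTrans.app x ≫ ((a.ext X).obj k).toFunctor.map p ≫ a.extDesc κ q =
      κ.toNatTrans.app x ≫ g.toFunctor.map r := by
  have h₁ := congrArg (fun t => t.toNatTrans.app x) (a.tilde_naturality κ)
  have h₂ := congrArg (fun t => t.toNatTrans.app x) (a.tilde_comp_extComp j g)
  have h₃ : g.toFunctor.map r ≫ (a.tilde g).hom.toNatTrans.app w =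
      (a.tilde g).hom.toNatTrans.app _ ≫
        ((a.ext Y).obj g).toFunctor.map ((T.unit Y).toFunctor.map r) :=
    (a.tilde g).hom.toNatTrans.naturality r
  simp at h₁ h₂
  have h₄ := congrArg ((a.ext Y).obj g).toFunctor.map hr
  simp at h₄
  simp [extDesc, -NatTrans.naturality, -NatTrans.naturality_assoc,
    NatTrans.naturality_assoc ((a.ext X).map κ).toNatTrans p,
    NatTrans.naturality_assoc (a.extComp j g).toNatTrans p]
  rw [← reassoc_of% h₁, reassoc_of% h₂, reassoc_of% h₄]
  rw [← reassoc_of% h₃]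
  simp

end Pseudoalgebra

lemma LaxMorphism.bar_comp_map_extDesc {a b : T.Pseudoalgebra} (h : LaxMorphism a b) {X Y : A}
    {j : J.obj X ⟶ J.obj Y}
    {k : J.obj X ⟶ a.carrier} {g : J.obj Y ⟶ a.carrier} (κ : k ⟶ j ≫ g) {P : T.obj X}
    {w : J.obj Y}
    (q : ((T.ext X Y).obj (j ≫ T.unit Y)).toFunctor.obj P ⟶ (T.unit Y).toFunctor.obj w) :
    (h.bar k).toNatTrans.app P ≫ h.hom.toFunctor.map (a.extDesc κ q) =
      b.extDesc (κ ▷ h.hom ≫ (α_ j g h.hom).hom) q := by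
  have h₀ : h.bar (j ≫ g) ≫ a.extComp j g ▷ h.hom =
      (b.ext X).map (α_ j g h.hom).hom ≫ b.extComp j (g ≫ h.hom) ≫
        (T.ext X Y).obj (j ≫ T.unit Y) ◁ h.bar g ≫
          (α_ ((T.ext X Y).obj (j ≫ T.unit Y)) ((a.ext Y).obj g) h.hom).inv := by
    rw [← h.bar_comp_extComp, ← Functor.map_comp_assoc, Iso.hom_inv_id, CategoryTheory.Functor.map_id,
      Category.id_comp]
  have h₁ := congrArg (fun t => t.toNatTrans.app P) h₀
  have h₂ := congrArg (fun t => t.toNatTrans.app P) (h.bar_naturality κ)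
  -- The unit law of `h`, solved for the inverse of `b.tilde`; invertibility of `h.bar` is not
  -- needed for this.
  have h₃ : (b.tilde (g ≫ h.hom)).inv =
      T.unit Y ◁ h.bar g ≫ (α_ (T.unit Y) ((a.ext Y).obj g) h.hom).inv ≫ (a.tilde g).inv ▷ h.hom := by
    rw [← cancel_epi (b.tilde (g ≫ h.hom)).hom, Iso.hom_inv_id, reassoc_of% h.unitality]
    simp
  have h₃' := congrArg (fun t => t.toNatTrans.app w) h₃
  simp at h₁ h₂ h₃'
  simp [Pseudoalgebra.extDesc]
  rw [h₃', ← reassoc_of% h₂, reassoc_of% h₁]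
  simp

namespace Pseudoalgebra

/-- `k^a` is a morphism from the free pseudoalgebra, so it carries descents to descents. The unit
law of `a` trades the extension of `tilde` followed by `hat` for the inverse of `theta`, leaving the
image under `k^a` of a single morphism out of `P`. -/
lemma extDesc_extMorphism (a : T.Pseudoalgebra) {X Y : A} {j : J.obj X ⟶ J.obj Y}
    (k : J.obj X ⟶ a.carrier) {u : J.obj Y ⟶ (free T X).carrier} (κ : T.unit X ⟶ j ≫ u)
    {P : T.obj X} {w : J.obj Y}
    (q : ((T.ext X Y).obj (j ≫ T.unit Y)).toFunctor.obj P ⟶ (T.unit Y).toFunctor.obj w) :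
    a.extDesc ((show k ⟶ T.unit X ≫ (a.extMorphism k).hom from (a.tilde k).hom) ≫
        κ ▷ (a.extMorphism k).hom ≫ (α_ j u (a.extMorphism k).hom).hom) q =
      (a.extMorphism k).hom.toFunctor.map
        ((T.theta X).inv.toNatTrans.app P ≫ (free T X).extDesc κ q) := by
  have h₁ := (a.extMorphism k).bar_comp_map_extDesc κ q
  have h₂ : (a.ext X).map (a.tilde k).hom ≫ (a.hat k (T.unit X)).hom =
      (λ_ ((a.ext X).obj k)).inv ≫ (T.theta X).inv ▷ (a.ext X).obj k := by
    rw [← a.unitality]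
    simp
  have h₂' : ((a.ext X).map (a.tilde k).hom).toNatTrans.app P ≫
      (a.hat k (T.unit X)).hom.toNatTrans.app P =
        ((a.ext X).obj k).toFunctor.map ((T.theta X).inv.toNatTrans.app P) := by
    simpa using congrArg (fun t => t.toNatTrans.app P) h₂
  refine (a.map_comp_extDesc (a.tilde k).hom _ q).symm.trans ?_
  refine (congrArg (((a.ext X).map (a.tilde k).hom).toNatTrans.app P ≫ ·) h₁.symm).trans ?_
  refine Eq.trans ?_ (Functor.map_comp _ _ _).symm
  exact (Category.assoc _ _ _).symm.trans (congrArg (· ≫ _) h₂')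

end Pseudoalgebra

end RelativePseudomonad

/-! ### Values at terminal objects as colimits -/

namespace RelativePseudomonad

variable {A : Type u₁} [Bicategory.{w₁, v₁} A] {J : A ⥤ᵖ Cat.{v₂, u₂}}
  {T : RelativePseudomonad J}

namespace Pseudoalgebra

/-- The cocone under `k` with vertex the value of `k^a` at a terminal object. -/
@[simps]
def extCocone (a : T.Pseudoalgebra) {X : A} (k : J.obj X ⟶ a.carrier) {P : T.obj X}
    (hP : IsTerminal P) : Cocone k.toFunctor where
  pt := ((a.ext X).obj k).toFunctor.obj P
  ι :=
    { app x := (a.tilde k).hom.toNatTrans.app x ≫ ((a.ext X).obj k).toFunctor.map (hP.from _)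
      naturality x y f := by
        have h : k.toFunctor.map f ≫ (a.tilde k).hom.toNatTrans.app y =
            (a.tilde k).hom.toNatTrans.app x ≫
              ((a.ext X).obj k).toFunctor.map ((T.unit X).toFunctor.map f) :=
          (a.tilde k).hom.toNatTrans.naturality f
        dsimp
        rw [reassoc_of% h, ← Functor.map_comp, Category.comp_id]
        congr 2
        exact hP.hom_ext _ _ }

/-- A cocone under `k`, seen as a 2-cell into the restriction of a constant functor. -/
@[simps]
def coconeHom₂ {C D E : Cat.{v₂, u₂}} (j : C ⟶ D) {k : C ⟶ E} (s : Cocone k.toFunctor) :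
    k ⟶ j ≫ ((Functor.const D).obj s.pt).toCatHom where
  toNatTrans :=
    { app x := s.ι.app x
      naturality _ _ f := s.ι.naturality f }

/-- The value of `k^a` at a terminal object is a colimit of `k`, as soon as `J X` maps to some
`J Y` with a terminal object preserved by the unit. -/
def isColimitExtCocone (a : T.Pseudoalgebra) {X Y : A} (k : J.obj X ⟶ a.carrier) {P : T.obj X}
    (hP : IsTerminal P) (j : J.obj X ⟶ J.obj Y) {w : J.obj Y} (hw : IsTerminal w)
    (hw' : IsTerminal ((T.unit Y).toFunctor.obj w)) : IsColimit (a.extCocone k hP) where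
  desc s := a.extDesc (coconeHom₂ j s) (hw'.from (((T.ext X Y).obj (j ≫ T.unit Y)).toFunctor.obj P))
  fac s x := by
    have h := a.tilde_comp_extDesc (coconeHom₂ j s)
      (hw'.from (((T.ext X Y).obj (j ≫ T.unit Y)).toFunctor.obj P)) (x := x) (hP.from _)
      (hw.from _) (hw'.hom_ext _ _)
    refine (Category.assoc _ _ _).trans (h.trans ?_)
    exact Category.comp_id _
  uniq s m hm := by
    let q := hw'.from (((T.ext X Y).obj (j ≫ T.unit Y)).toFunctor.obj P)
    let c := a.extCocone k hP
    let γ : ((Functor.const (J.obj Y)).obj c.pt).toCatHom ⟶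
      ((Functor.const (J.obj Y)).obj s.pt).toCatHom := ((Functor.const _).map m).toCatHom₂
    have h₁ : coconeHom₂ j s = coconeHom₂ j c ≫ j ◁ γ := by
      ext x
      exact (hm x).symm
    -- By naturality in the vertex, `m` equals the descent of `s` once the descent of `c` is the
    -- identity.
    have h₂ : a.extDesc (coconeHom₂ j s) q = a.extDesc (coconeHom₂ j c) q ≫ m := by
      rw [h₁]
      exact (a.extDesc_comp (coconeHom₂ j c) γ q).symm
    -- The universal instance: the cocone in `T.obj X` under the unit, with vertex the terminal `P`.
    -- Its image under `k^a`, preceded by `a.tilde k`, is `c`.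
    let u : J.obj Y ⟶ (free T X).carrier := ((Functor.const (J.obj Y)).obj P).toCatHom
    let κ : T.unit X ⟶ j ≫ u := coconeHom₂ j (k := T.unit X)
      { pt := P, ι := { app x := hP.from _, naturality _ _ _ := hP.hom_ext _ _ } }
    -- Identifies the constant functor at `P` followed by `k^a` with the constant functor at `k^a
    -- P`.
    let δ : u ≫ (a.extMorphism k).hom ⟶ ((Functor.const (J.obj Y)).obj c.pt).toCatHom :=
      Cat.Hom₂.ofNatTrans
        { app _ := 𝟙 c.pt
          naturality _ _ _ := congrArg (· ≫ 𝟙 c.pt)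
            (CategoryTheory.Functor.map_id ((a.ext X).obj k).toFunctor P) }
    have h₃ : coconeHom₂ j c = ((show k ⟶ T.unit X ≫ (a.extMorphism k).hom from (a.tilde k).hom) ≫
        κ ▷ (a.extMorphism k).hom ≫ (α_ j u (a.extMorphism k).hom).hom) ≫ j ◁ δ := by
      ext x
      exact ((Category.comp_id _).trans
        (congrArg ((a.tilde k).hom.toNatTrans.app x ≫ ·) (Category.comp_id _))).symm
    have h₄ : a.extDesc (coconeHom₂ j c) q = 𝟙 _ := by
      rw [h₃]
      refine (a.extDesc_comp _ δ q).symm.trans ((Category.comp_id _).trans ?_)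
      refine (a.extDesc_extMorphism k κ q).trans ?_
      refine (congrArg _ (hP.hom_ext _ (𝟙 P))).trans (CategoryTheory.Functor.map_id _ _)
    refine Eq.trans ?_ h₂.symm
    rw [h₄]
    exact (Category.id_comp _).symm

end Pseudoalgebra

/-- The comparison between the image of `extCocone` under a pseudomorphism and `extCocone`. -/
noncomputable def LaxMorphism.IsPseudomorphism.mapExtCoconeIso {a b : T.Pseudoalgebra}
    {h : LaxMorphism a b} (hh : h.IsPseudomorphism) {X : A} (k : J.obj X ⟶ a.carrier)
    {P : T.obj X} (hP : IsTerminal P) :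
    b.extCocone (k ≫ h.hom) hP ≅ h.hom.toFunctor.mapCocone (a.extCocone k hP) :=
  have := hh X k
  Cocone.ext ((Cat.Hom.toNatIso (asIso (h.bar k))).app P) (fun x => by
    -- The legs agree by the unit law of `h` followed by naturality of `h.bar k` at the map to `P`.
    have h₁ := congrArg (fun t => t.toNatTrans.app x) (h.unitality k)
    simp at h₁
    have h₂ : ((b.ext X).obj (k ≫ h.hom)).toFunctor.map (hP.from _) ≫
        (h.bar k).toNatTrans.app P = (h.bar k).toNatTrans.app _ ≫
          h.hom.toFunctor.map (((a.ext X).obj k).toFunctor.map (hP.from _)) :=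
      (h.bar k).toNatTrans.naturality (hP.from ((T.unit X).toFunctor.obj x))
    refine (Category.assoc _ _ _).trans ((congrArg (_ ≫ ·) h₂).trans ?_)
    exact (Category.assoc _ _ _).symm.trans
      ((congrArg (· ≫ _) h₁).trans (h.hom.toFunctor.map_comp _ _).symm))

end RelativePseudomonad

/-- Transposition along a left extension. -/
noncomputable def ExhibitsLeftExtension.homEquiv {E : Type u₂} [Bicategory.{w₂, v₂} E] {X Y Z : E}
    {i : X ⟶ Y} {f : X ⟶ Z} {e : Y ⟶ Z} {η : f ⟶ i ≫ e} (hη : ExhibitsLeftExtension i η)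
    (k : Y ⟶ Z) : (e ⟶ k) ≃ (f ⟶ i ≫ k) where
  toFun γ := η ≫ i ◁ γ
  invFun β := hη.desc β
  left_inv _ := hη.hom_ext (hη.fac _)
  right_inv β := hη.fac β

/-! ### Terminal presheaves in the free cocompletion, and the three conclusions -/

section
attribute [local instance] uliftCategory

variable {Φ Φ' : ObjectProperty Cat.{v, v}}

/-- The terminal presheaf is the colimit of the Yoneda embedding, whose shape `D` is in `Φ`:
evaluated at `d` this is the colimit of the functor `D(d, -)`, a point. -/
lemma cocompletionProp_const_punit {D : Cat.{v, v}} (hD : Φ D) :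
    cocompletionProp Φ D ((Functor.const _).obj PUnit) := by
  let c : Cocone (yoneda (C := D)) :=
    { pt := (Functor.const _).obj PUnit
      ι := { app d := { app _ := ↾fun _ => PUnit.unit } } }
  have hc : IsColimit c := evaluationJointlyReflectsColimits _ (fun d =>
    Coyoneda.colimitCoconeIsColimit d)
  exact .of_colimitPresentation (a := ⟨D, hD⟩) ⟨_, c.ι, hc⟩
    (fun d => ObjectProperty.le_colimitsClosure _ _ _ (ObjectProperty.ofObj_apply _ d))

/-- A presheaf all of whose values are singletons is terminal in the free `Φ`-cocompletion. -/
def Cocompletion.isTerminalOfUnique {X : Type v} [Category.{v} X] (P : Cocompletion Φ X)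
    (hP : ∀ x, Unique (P.obj.obj x)) : IsTerminal P :=
  IsTerminal.ofUniqueHom
    (fun Q => ObjectProperty.homMk
      { app x := ↾fun _ => (hP x).default
        naturality _ _ _ := by ext; exact (hP _).instSubsingleton.elim _ _ })
    (fun Q m => by
      ext x y
      exact (hP x).instSubsingleton.elim _ _)

/-- The terminal presheaf is terminal in the free `Φ`-cocompletion. -/
def Cocompletion.isTerminalConst {D : Cat.{v, v}} (hD : Φ D) :
    IsTerminal (⟨_, cocompletionProp_const_punit hD⟩ : Cocompletion Φ D) :=
  Cocompletion.isTerminalOfUnique _ (fun _ => PUnit.instUnique)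

namespace RelativePseudomonad.Pseudoalgebra

variable (a : (cocompletionOn Φ Φ').Pseudoalgebra)

lemma nonempty_isColimit_extCocone
    (htop : ∀ D : Cat.{v, v}, Φ D → Φ' (Cat.of (WithTerminal D))) {D : Cat.{v, v}} (hD : Φ D) (hD' : Φ' D)
    (k : Cat.of (ULift.{v + 1} D) ⟶ a.carrier) {P : Cocompletion Φ D} (hP : IsTerminal P) :
    Nonempty (IsColimit (a.extCocone (X := (⟨D, hD'⟩ : Subtype Φ')) k hP)) := by
  let j : Cat.of (ULift.{v + 1} D) ⟶ Cat.of (ULift.{v + 1} (WithTerminal D)) :=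
    (ULift.downFunctor ⋙ WithTerminal.incl ⋙ ULift.upFunctor).toCatHom
  let w : ULift.{v + 1} (WithTerminal D) := ⟨WithTerminal.star⟩
  have (x : ULift.{v + 1} (WithTerminal D)) : Unique (x ⟶ w) :=
    inferInstanceAs (Unique (x.down ⟶ WithTerminal.star))
  have hw : IsTerminal w := IsTerminal.ofUnique w
  exact ⟨a.isColimitExtCocone (X := (⟨D, hD'⟩ : Subtype Φ'))
    (Y := (⟨Cat.of (WithTerminal D), htop D hD⟩ : Subtype Φ')) k hP j hw
    -- The presheaf represented by `⊤` has the singleton `Hom(x, ⊤)` as its value at each `x`.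
    (Cocompletion.isTerminalOfUnique ((cocompletionUnit Φ (WithTerminal D)).obj w)
      (fun x => (inferInstance : Unique (x.unop ⟶ WithTerminal.star))))⟩

lemma isCocompleteFor (hle : Φ ≤ Φ')
    (htop : ∀ D : Cat.{v, v}, Φ D → Φ' (Cat.of (WithTerminal D))) :
    IsCocompleteFor Φ a.carrier := by
  intro D hD
  have : HasColimitsOfShape (ULift.{v + 1} D) a.carrier :=
    { has_colimit K :=
        let ⟨h⟩ := a.nonempty_isColimit_extCocone htop hD (hle D hD) K.toCatHom
          (Cocompletion.isTerminalConst hD)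
        ⟨⟨_, h⟩⟩ }
  exact hasColimitsOfShape_of_equivalence (ULift.equivalence (C := D)).symm

end RelativePseudomonad.Pseudoalgebra

namespace RelativePseudomonad.LaxMorphism.IsPseudomorphism

/-- It suffices to preserve one colimit cocone of each diagram. For the cocone with vertex `k^a P`,
the image is isomorphic to the cocone that the target pseudoalgebra builds for `k ≫ h.hom`, itself
colimiting. -/
lemma isCocontinuousFor (hle : Φ ≤ Φ')
    (htop : ∀ D : Cat.{v, v}, Φ D → Φ' (Cat.of (WithTerminal D)))
    {a b : (cocompletionOn Φ Φ').Pseudoalgebra} {h : LaxMorphism a b} (hh : h.IsPseudomorphism) :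
    IsCocontinuousFor Φ h.hom.toFunctor := by
  intro D hD
  have hP := Cocompletion.isTerminalConst hD
  have : PreservesColimitsOfShape (ULift.{v + 1} D) h.hom.toFunctor :=
    { preservesColimit {K} := by
        let k : Cat.of (ULift.{v + 1} D) ⟶ a.carrier := K.toCatHom
        obtain ⟨h₁⟩ := a.nonempty_isColimit_extCocone htop hD (hle D hD) k hP
        obtain ⟨h₂⟩ := b.nonempty_isColimit_extCocone htop hD (hle D hD) (k ≫ h.hom) hP
        exact preservesColimit_of_preserves_colimit_cocone h₁
          (h₂.ofIsoColimit (hh.mapExtCoconeIso (X := (⟨D, hle D hD⟩ : Subtype Φ')) k hP)) }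
  exact preservesColimitsOfShape_of_equiv (ULift.equivalence (C := D)).symm _

end RelativePseudomonad.LaxMorphism.IsPseudomorphism

namespace RelativePseudomonad.Pseudoalgebra

/-- A pseudoalgebra whose extension operator is given by left extension along the unit is
lax-idempotent. -/
lemma isLaxIdempotent_of_exhibitsLeftExtension {A : Type u₁} [Bicategory.{w₁, v₁} A] {E : Type u₂}
    [Bicategory.{w₂, v₂} E] {J : A ⥤ᵖ E} {T : RelativePseudomonad J} (a : T.Pseudoalgebra)
    (ha : ∀ (X : A) (f : J.obj X ⟶ a.carrier),
      ExhibitsLeftExtension (T.unit X) (a.tilde f).hom) :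
    a.IsLaxIdempotent := fun X =>
  ⟨Adjunction.mkOfHomEquiv
    { homEquiv f k := (ha X f).homEquiv k
      homEquiv_naturality_left_symm φ β := by
        refine (ha X _).hom_ext (((ha X _).fac _).trans ?_)
        rw [Bicategory.whiskerLeft_comp, ← reassoc_of% a.tilde_naturality]
        exact congrArg (φ ≫ ·) ((ha X _).fac β).symm
      homEquiv_naturality_right {f _ _} γ δ :=
        (congrArg ((a.tilde f).hom ≫ ·) (Bicategory.whiskerLeft_comp _ γ δ)).trans
          (Category.assoc _ _ _).symm },
    fun f => by
      rw [Adjunction.mkOfHomEquiv_unit_app]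
      exact (congrArg ((a.tilde f).hom ≫ ·) (Bicategory.whiskerLeft_id _ _)).trans
        (Category.comp_id _)⟩

/-- Cocontinuity of pseudomorphisms, applied to `f^a` itself, makes it a `Φ`-cocontinuous functor on
`Φ̄(X)`; since `tilde` is invertible, such a functor is a left extension of `f`. -/
lemma isLaxIdempotent (a : (cocompletionOn Φ Φ').Pseudoalgebra) (hle : Φ ≤ Φ')
    (htop : ∀ D : Cat.{v, v}, Φ D → Φ' (Cat.of (WithTerminal D))) : a.IsLaxIdempotent := by
  refine a.isLaxIdempotent_of_exhibitsLeftExtension (fun X f => ?_)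
  refine exhibitsLeftExtension_of_isLeftKanExtension _ _ ?_
  let H : Cocompletion Φ X.1 ⥤ a.carrier := ((a.ext X).obj f).toFunctor
  have hH : IsCocontinuousFor Φ H :=
    (a.extMorphism_isPseudomorphism f).isCocontinuousFor hle htop
  let F : ULift.{v + 1} X.1 ⥤ a.carrier := f.toFunctor
  let α : F ≅ cocompletionUnit Φ X.1 ⋙ H := Cat.Hom.toNatIso (a.tilde f)
  exact cocompletion_isLeftKanExtension hH α.hom

end RelativePseudomonad.Pseudoalgebra

end

theorem mainTheorem11 (Φ Φ' : ObjectProperty Cat.{v, v}) (hle : Φ ≤ Φ')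
    (htop : ∀ D : Cat.{v, v}, Φ D → Φ' (Cat.of (WithTerminal D))) :
    (∀ a : (cocompletionOn Φ Φ').Pseudoalgebra, IsCocompleteFor Φ a.carrier) ∧
    (∀ (a b : (cocompletionOn Φ Φ').Pseudoalgebra) (h : RelativePseudomonad.LaxMorphism a b),
      h.IsPseudomorphism → IsCocontinuousFor Φ h.hom.toFunctor) ∧
    (∀ a : (cocompletionOn Φ Φ').Pseudoalgebra, a.IsLaxIdempotent) :=
  ⟨fun a => a.isCocompleteFor hle htop, fun _ _ _ hh => hh.isCocontinuousFor hle htop,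
    fun a => a.isLaxIdempotent hle htop⟩
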